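/- **Setting.** Let $\Theta$ (states), $T=\{t_1,\dots,t_n\}$ (agent types) and $A$ (actions) be finite non-empty sets, $\mu\in\Delta(\Theta)$ a prior, $\rho\in\Delta(T)$ a type distribution independent of the state, $v(\theta,a)\in\mathbb R$ the principal's payoff and $u_t(\theta,a)\in\mathbb R$ the payoff of an agent of type $t$. An *indefinite-stage mechanism* $\Pi$ is a finite rooted tree whose nodes are: $\mathsf S$ nodes, with a finite signal set $G$, a signaling strategy $\pi:\Theta\to\Delta(G)$ and one child for each signal; $\mathsf E$ nodes (binding elicitation), where the agent reports a type, with one child for each type; $\widetilde{\mathsf E}$ nodes (non-binding elicitation), where the agent freely selects one of finitely many children; and leaves. Starting at the root, signals are drawn according to $\pi(\cdot\mid\theta)$, with $\theta\sim\mu$, and the agent's (possibly mixed) choices determine the path. The belief at a node reached through $\mathsf S$-node signals $g_1,\dots,g_m$ with strategies $\pi_1,\dots,\pi_m$ is given, up to normalization, by the weights $w(\theta)=\mu(\theta)\prod_{l}\pi_l(g_l\mid\theta)$; an action $a$ is *optimal for type $t$ at this node* if it maximizes $\sum_\theta w(\theta)u_t(\theta,a)$ over $A$. The agent is *credible*: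 once a type $t_k$ is reported, the agent repeats this report whenever the type is elicited again, and at the leaf plays an action optimal for $t_k$; if no type was reported before the leaf, the agent is free to play an optimal action of any type. Ties among the optimal actions of the type as which the agent acts are broken by the mechanism (possibly at random, and irrespective of the agent's actual type). Given this, an agent of actual type $t$ chooses options and reports so as to maximize the expectation of $u_t$, and the mechanism again decides between optimal choices. The principal's payoff is the resulting expectation of $v$ over $t\sim\rho$, $\theta\sim\mu$, the signals and the choices. **Theorem.** For every indefinite-stage mechanism $\Pi$ (with any tie-breaking as above, that is, any optimal responses of the agent types) there is an $\widetilde{\mathsf E}\mathsf S\mathsf E\mathsf S$ mechanism $\Pi'$ (levels, from the root: $\widetilde{\mathsf E}$, $\mathsf S$, $\mathsf E$, $\mathsf S$, leaves) that yields at least as much payoff for the principal as $\Pi$ does, and that has the following properties. 1. *IC at $\widetilde{\mathsf E}$.* The root has $n$ children $\mathsf S_1,\dots,\mathsf S_n$, all $\mathsf S$ nodes, and for each $i$ it is optimal for an agent of type $t_i$ to select $\mathsf S_i$ (and then to follow the recommendations below). 2. *DIC at $\mathsf S_i$.* Each $\mathsf S_i$ has signal set $T$ and $n$ children $\mathsf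 E_{i1},\dots,\mathsf E_{in}$, all $\mathsf E$ nodes, where $\mathsf E_{ij}$ follows the signal $t_j$; at $\mathsf E_{ij}$ it is optimal for an agent of type $t_i$ to report $t_j$. For each $k$, reporting $t_k$ at $\mathsf E_{ij}$ leads to an $\mathsf S$ node $\mathsf S_{ijk}$. 3. *DIC at $\mathsf S_{ijk}$.* Each $\mathsf S_{ijk}$ has signal set $A$; each signal $a$ leads to a leaf at which $a$ is played, and $a$ is optimal for type $t_k$ there. The payoff of $\Pi'$ is the one obtained when each type $t_i$ selects $\mathsf S_i$, reports the recommended types and plays the recommended actions. -/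

import Mathlib

universe u

namespace CrediblePersuasion

noncomputable section

/-- The data of a persuasion problem with a privately informed agent: a common prior `μ` on the
states, a distribution `ρ` of the agent's type, the principal's payoff `v`, and the payoff
`util t` of an agent of type `t`. Here `stdSimplex ℝ S` is the set `Δ(S)` of probability
distributions on the finite set `S`. -/
structure Problem (Θ T A : Type u) [Fintype Θ] [Fintype T] [Fintype A] where
  μ : stdSimplex ℝ Θ
  ρ : stdSimplex ℝ T
  v : Θ → A → ℝ
  util : T → Θ → A → ℝ

/-- Indefinite-stage mechanisms: finite trees, of any depth and shape, built from
* leaves; `play k` is the (possibly mixed) action of an agent who acts as type `k`, that is, the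
  mechanism's way of breaking ties among the optimal actions of type `k` (see `IsCredible`);
* `S` nodes, with a finite signal set `G` and a signaling strategy `π : Θ → Δ(G)`;
* `E` nodes (binding elicitation), with one child for each type;
* `Ẽ` nodes (non-binding elicitation), with a finite non-empty set `C` of options. -/
inductive Mechanism (Θ T A : Type u) [Fintype A] : Type (u + 1)
  | leaf (play : T → stdSimplex ℝ A) : Mechanism Θ T A
  | signal (G : Type u) [Fintype G] (π : Θ → stdSimplex ℝ G) (next : G → Mechanism Θ T A) :
      Mechanism Θ T A
  | elicit (next : T → Mechanism Θ T A) : Mechanism Θ T A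
  | menu (C : Type u) [Fintype C] [Nonempty C] (next : C → Mechanism Θ T A) : Mechanism Θ T A

section Semantics

variable {Θ T A : Type u} [Fintype Θ] [Fintype T] [Fintype A]

/-- Behavioural strategies of the agent in a mechanism: a distribution over the reports at each
`E` node, over the options at each `Ẽ` node, and, at each leaf, over the types as which the agent
acts (this last choice matters only if no type has been reported before the leaf; likewise the
choice at an `E` node matters only if no type has been reported before it). -/
inductive Strategy : Mechanism Θ T A → Type (u + 1)
  | leaf {play : T → stdSimplex ℝ A} (p : stdSimplex ℝ T) : Strategy (.leaf play)
  | signal {G : Type u} [Fintype G] {π : Θ → stdSimplex ℝ G} {next : G → Mechanism Θ T A}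
      (cont : (g : G) → Strategy (next g)) : Strategy (.signal G π next)
  | elicit {next : T → Mechanism Θ T A} (p : stdSimplex ℝ T)
      (cont : (k : T) → Strategy (next k)) : Strategy (.elicit next)
  | menu {C : Type u} [Fintype C] [Nonempty C] {next : C → Mechanism Θ T A} (p : stdSimplex ℝ C)
      (cont : (c : C) → Strategy (next c)) : Strategy (.menu C next)

/-- Expected value of `f(θ, a)` in the (sub)tree when the agent follows the given strategy.

`w θ` is the joint probability of the state `θ` and of the signals that lead to the root of the
subtree, that is, the agent's unnormalized belief there. The argument of type `Option T` is the
type reported so far, if any: it binds the agent, who acts as that type at the leaves and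
repeats that report whenever the type is elicited again. If no type has been reported, the agent
is free at a leaf to act as any type. -/
def value (f : Θ → A → ℝ) : {M : Mechanism Θ T A} → Strategy M → Option T → (Θ → ℝ) → ℝ
  | _, @Strategy.leaf _ _ _ _ _ play _, some k, w => ∑ θ, w θ * ∑ a, play k a * f θ a
  | _, @Strategy.leaf _ _ _ _ _ play p, none, w =>
      ∑ k, p k * ∑ θ, w θ * ∑ a, play k a * f θ a
  | _, @Strategy.signal _ _ _ _ _ _ _ π _ cont, r, w =>
      ∑ g, value f (cont g) r (fun θ => w θ * π θ g)
  | _, .elicit _ cont, some k, w => value f (cont k) (some k) w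
  | _, .elicit p cont, none, w => ∑ k, p k * value f (cont k) (some k) w
  | _, @Strategy.menu _ _ _ _ _ _ _ _ _ p cont, r, w => ∑ c, p c * value f (cont c) r w

/-- The action `a` is optimal for type `k` under the unnormalized belief `w`. -/
def IsOptimalAction (P : Problem Θ T A) (k : T) (w : Θ → ℝ) (a : A) : Prop :=
  ∀ b : A, ∑ θ, w θ * P.util k θ b ≤ ∑ θ, w θ * P.util k θ a

/-- Credibility of the play at the leaves: an agent who has reported `k` plays only actions that
are optimal for type `k` under the belief at the leaf; at a leaf before which no type has been
reported, this holds for every type `k` as which the agent may choose to act. -/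
def IsCredible (P : Problem Θ T A) : Mechanism Θ T A → Option T → (Θ → ℝ) → Prop
  | .leaf play, some k, w => ∀ a, 0 < play k a → IsOptimalAction P k w a
  | .leaf play, none, w => ∀ k a, 0 < play k a → IsOptimalAction P k w a
  | @Mechanism.signal _ _ _ _ _ _ π next, r, w => ∀ g, IsCredible P (next g) r (fun θ => w θ * π θ g)
  | .elicit next, some k, w => IsCredible P (next k) (some k) w
  | .elicit next, none, w => ∀ k, IsCredible P (next k) (some k) w
  | @Mechanism.menu _ _ _ _ _ _ _ next, r, w => ∀ c, IsCredible P (next c) r w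

/-- The strategy `s` maximizes the payoff of an agent of actual type `t` in the subtree `M`. -/
def IsBestResponse (P : Problem Θ T A) (t : T) (M : Mechanism Θ T A) (s : Strategy M)
    (r : Option T) (w : Θ → ℝ) : Prop :=
  ∀ s' : Strategy M, value (P.util t) s' r w ≤ value (P.util t) s r w

/-- The principal's expected payoff when an agent of type `t` follows the strategy `s t`. -/
def principalPayoff (P : Problem Θ T A) (M : Mechanism Θ T A) (s : T → Strategy M) : ℝ :=
  ∑ t, P.ρ t * value P.v (s t) none P.μ

end Semantics

section Direct

variable {Θ T A : Type u} [Fintype T] [Fintype A]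

open Classical in
/-- The node `S_{ijk}` with strategy `φ : Θ → Δ(A)`: its signals are actions, and after the signal
`a` the mechanism ends and `a` is played. -/
def nodeS (φ : Θ → stdSimplex ℝ A) : Mechanism Θ T A :=
  .signal A φ fun a => .leaf fun _ => stdSimplex.vertex a

/-- The node `E_{ij}`: reporting `k` leads to the node `S_{ijk}` with strategy `φ k`. -/
def nodeE (φ : T → Θ → stdSimplex ℝ A) : Mechanism Θ T A :=
  .elicit fun k => nodeS (φ k)

/-- The `Ẽ`-`S`-`E`-`S` mechanism with direct recommendations. The root is an `Ẽ` node with one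
child `S_i` for each type `i`; the signals of `S_i`, drawn by `π i : Θ → Δ(T)`, are types `j` and
lead to the nodes `E_{ij}`; reporting `k` there leads to the node `S_{ijk}`, whose signals, drawn
by `φ i j k : Θ → Δ(A)`, are actions. -/
def directMechanism [Nonempty T] (π : T → Θ → stdSimplex ℝ T)
    (φ : T → T → T → Θ → stdSimplex ℝ A) : Mechanism Θ T A :=
  .menu T fun i => .signal T (π i) fun j => nodeE (φ i j)

open Classical in
/-- The strategy at `E_{ij}` that reports the recommended type `j`. (The choice of a type at the
leaves has no effect, as a type has been reported.) -/
def obeyE (φ : T → Θ → stdSimplex ℝ A) (j : T) : Strategy (nodeE φ) :=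
  .elicit (stdSimplex.vertex j) fun _ => .signal fun _ => .leaf (stdSimplex.vertex j)

open Classical in
/-- The strategy in `directMechanism π φ` that selects the child `S_i` at the root and then
reports the recommended type. -/
def obey [Nonempty T] (π : T → Θ → stdSimplex ℝ T) (φ : T → T → T → Θ → stdSimplex ℝ A)
    (i : T) : Strategy (directMechanism π φ) :=
  .menu (stdSimplex.vertex i) fun l => .signal fun j => obeyE (φ l j) j

end Direct

end

end CrediblePersuasion

namespace CrediblePersuasion

noncomputable section

/-! ### Optimality as a convex cone condition on beliefs. -/

section OptimalActions

variable {Θ T A : Type u} [Fintype Θ] [Fintype T] [Fintype A]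

/-! A revelation principle for binding reports. The strategy `s i` is condensed into the law of its
first report `j` and, for every alternative report `k`, the law of the resulting action. The nodes
`S_i` and `S_{ijk}` simulate these laws, so obedience reproduces the value of every `f(θ, a)`, and
the principal's payoff is in fact unchanged.

Credibility survives the merging of nodes because optimality of an action is a system of homogeneous
linear inequalities in the unnormalized belief, hence stable under nonnegative combinations
(`isOptimalAction_jointLaw`). Incentives survive because selecting `S_l` and then misreporting earns
exactly what `s l` with redirected reports earns in `M` (`value_redirect`), which cannot beat `s i`
for type `i`. -/

theorem isOptimalAction_sum {ι : Type*} [Fintype ι] {P : Problem Θ T A} {k : T} {a : A}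
    {w : ι → Θ → ℝ} (h : ∀ i, IsOptimalAction P k (w i) a) :
    IsOptimalAction P k (fun θ => ∑ i, w i θ) a := by
  intro b
  simp only [Finset.sum_mul]
  rw [Finset.sum_comm, Finset.sum_comm (s := Finset.univ (α := Θ))]
  exact Finset.sum_le_sum fun i _ => h i b

/-- Optimality is needed only for `0 < c` because credibility constrains only actions played with
positive probability; for `c = 0` the belief vanishes. -/
theorem IsOptimalAction.const_mul {P : Problem Θ T A} {k : T} {a : A} {w : Θ → ℝ} {c : ℝ}
    (hc : 0 ≤ c) (h : 0 < c → IsOptimalAction P k w a) :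
    IsOptimalAction P k (fun θ => c * w θ) a := by
  intro b
  simp only [mul_assoc, ← Finset.mul_sum]
  rcases hc.eq_or_lt with rfl | hc'
  · simp
  · exact mul_le_mul_of_nonneg_left (h hc' b) hc

end OptimalActions

/-! ### Laws of reports and actions induced by a strategy, and the payoffs they determine. -/

section Laws

variable {Θ T A : Type u} [Fintype T] [Fintype A]

/-- The probability of the action `a` in state `θ` when type `k` has been reported before. -/
def boundLaw : {M : Mechanism Θ T A} → Strategy M → T → Θ → A → ℝ
  | _, @Strategy.leaf _ _ _ _ _ play _, k, _, a => play k a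
  | _, @Strategy.signal _ _ _ _ _ _ _ π _ cont, k, θ, a => ∑ g, π θ g * boundLaw (cont g) k θ a
  | _, .elicit _ cont, k, θ, a => boundLaw (cont k) k θ a
  | _, @Strategy.menu _ _ _ _ _ _ _ _ _ p cont, k, θ, a => ∑ c, p c * boundLaw (cont c) k θ a

/-- The probability in state `θ` that `j` is the first type reported, or the type as which the
agent acts at a leaf if none is reported before. -/
def reportLaw : {M : Mechanism Θ T A} → Strategy M → T → Θ → ℝ
  | _, .leaf p, j, _ => p j
  | _, @Strategy.signal _ _ _ _ _ _ _ π _ cont, j, θ => ∑ g, π θ g * reportLaw (cont g) j θ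
  | _, .elicit p _, j, _ => p j
  | _, @Strategy.menu _ _ _ _ _ _ _ _ _ p cont, j, θ => ∑ c, p c * reportLaw (cont c) j θ

/-- The probability in state `θ` that the strategy prescribes `j` as first report and that
reporting `k` instead of `j` leads to the action `a`. -/
def jointLaw : {M : Mechanism Θ T A} → Strategy M → T → T → Θ → A → ℝ
  | _, @Strategy.leaf _ _ _ _ _ play p, j, k, _, a => p j * play k a
  | _, @Strategy.signal _ _ _ _ _ _ _ π _ cont, j, k, θ, a =>
      ∑ g, π θ g * jointLaw (cont g) j k θ a
  -- The continuation is the one that the strategy itself holds after `k`, even if `k` is off its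
  -- path, so this is a deviation available in the original mechanism.
  | _, .elicit p cont, j, k, θ, a => p j * boundLaw (cont k) k θ a
  | _, @Strategy.menu _ _ _ _ _ _ _ _ _ p cont, j, k, θ, a =>
      ∑ c, p c * jointLaw (cont c) j k θ a

/-- The distribution of a report drawn from `σ j`, where `j` is drawn from `p`. -/
def mixReports (p : stdSimplex ℝ T) (σ : T → stdSimplex ℝ T) : stdSimplex ℝ T :=
  ⟨fun k => ∑ j, p j * σ j k,
    fun k => Finset.sum_nonneg fun j _ => mul_nonneg (p.2.1 j) ((σ j).2.1 k), by
      rw [Finset.sum_comm]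
      simp only [← Finset.mul_sum]
      have h : ∀ j, ∑ k, σ j k = 1 := fun j => (σ j).2.2
      simp only [h, mul_one]
      exact p.2.2⟩

theorem mixReports_apply (p : stdSimplex ℝ T) (σ : T → stdSimplex ℝ T) (k : T) :
    mixReports p σ k = ∑ j, p j * σ j k := rfl

/-- The strategy that reports a type drawn from `σ j` whenever the given one makes `j` its first
report, and that otherwise follows the given one. -/
def redirect (σ : T → stdSimplex ℝ T) : {M : Mechanism Θ T A} → Strategy M → Strategy M
  | _, .leaf p => .leaf (mixReports p σ)
  | _, @Strategy.signal _ _ _ _ _ _ _ _ _ cont => .signal fun g => redirect σ (cont g)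
  | _, .elicit p cont => .elicit (mixReports p σ) cont
  | _, @Strategy.menu _ _ _ _ _ _ _ _ _ p cont => .menu p fun c => redirect σ (cont c)

theorem boundLaw_nonneg {M : Mechanism Θ T A} (s : Strategy M) (k : T) (θ : Θ) (a : A) :
    0 ≤ boundLaw s k θ a := by
  induction s with
  | leaf p => exact (Subtype.property _ : _ ∈ stdSimplex ℝ A).1 a
  | signal cont ih =>
    exact Finset.sum_nonneg fun g _ =>
      mul_nonneg ((Subtype.property _ : _ ∈ stdSimplex ℝ _).1 g) (ih g)
  | elicit p cont ih => exact ih k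
  | menu p cont ih => exact Finset.sum_nonneg fun c _ => mul_nonneg (p.2.1 c) (ih c)

theorem reportLaw_nonneg {M : Mechanism Θ T A} (s : Strategy M) (j : T) (θ : Θ) :
    0 ≤ reportLaw s j θ := by
  induction s with
  | leaf p => exact p.2.1 j
  | signal cont ih =>
    exact Finset.sum_nonneg fun g _ =>
      mul_nonneg ((Subtype.property _ : _ ∈ stdSimplex ℝ _).1 g) (ih g)
  | elicit p cont ih => exact p.2.1 j
  | menu p cont ih => exact Finset.sum_nonneg fun c _ => mul_nonneg (p.2.1 c) (ih c)

theorem jointLaw_nonneg {M : Mechanism Θ T A} (s : Strategy M) (j k : T) (θ : Θ) (a : A) :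
    0 ≤ jointLaw s j k θ a := by
  induction s with
  | leaf p => exact mul_nonneg (p.2.1 j) ((Subtype.property _ : _ ∈ stdSimplex ℝ A).1 a)
  | signal cont ih =>
    exact Finset.sum_nonneg fun g _ =>
      mul_nonneg ((Subtype.property _ : _ ∈ stdSimplex ℝ _).1 g) (ih g)
  | elicit p cont ih => exact mul_nonneg (p.2.1 j) (boundLaw_nonneg _ _ _ _)
  | menu p cont ih => exact Finset.sum_nonneg fun c _ => mul_nonneg (p.2.1 c) (ih c)

theorem sum_boundLaw {M : Mechanism Θ T A} (s : Strategy M) (k : T) (θ : Θ) :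
    ∑ a, boundLaw s k θ a = 1 := by
  induction s with
  | leaf p => exact stdSimplex.sum_eq_one _
  | signal cont ih =>
    simp only [boundLaw]
    rw [Finset.sum_comm]
    simp only [← Finset.mul_sum, ih, mul_one, stdSimplex.sum_eq_one]
  | elicit p cont ih => exact ih k
  | menu p cont ih =>
    simp only [boundLaw]
    rw [Finset.sum_comm]
    simp only [← Finset.mul_sum, ih, mul_one, stdSimplex.sum_eq_one]

theorem sum_reportLaw {M : Mechanism Θ T A} (s : Strategy M) (θ : Θ) :
    ∑ j, reportLaw s j θ = 1 := by
  induction s with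
  | leaf p => exact stdSimplex.sum_eq_one _
  | signal cont ih =>
    simp only [reportLaw]
    rw [Finset.sum_comm]
    simp only [← Finset.mul_sum, ih, mul_one, stdSimplex.sum_eq_one]
  | elicit p cont ih => exact stdSimplex.sum_eq_one _
  | menu p cont ih =>
    simp only [reportLaw]
    rw [Finset.sum_comm]
    simp only [← Finset.mul_sum, ih, mul_one, stdSimplex.sum_eq_one]

/-- Replacing the report affects only what happens after `j` is prescribed. Hence one normalization
serves every `k`, and the signal `j` can be drawn before the report. -/
theorem sum_jointLaw {M : Mechanism Θ T A} (s : Strategy M) (j k : T) (θ : Θ) :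
    ∑ a, jointLaw s j k θ a = reportLaw s j θ := by
  induction s with
  | leaf p => simp only [jointLaw, reportLaw, ← Finset.mul_sum, mul_one, stdSimplex.sum_eq_one]
  | signal cont ih =>
    simp only [jointLaw, reportLaw]
    rw [Finset.sum_comm]
    simp only [← Finset.mul_sum, ih]
  | elicit p cont ih => simp only [jointLaw, reportLaw, ← Finset.mul_sum, mul_one, sum_boundLaw]
  | menu p cont ih =>
    simp only [jointLaw, reportLaw]
    rw [Finset.sum_comm]
    simp only [← Finset.mul_sum, ih]

variable [Fintype Θ]

/-- The expectation of `f(θ, a)` for the unnormalized belief `w` and the action law `q`. -/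
def expect (f : Θ → A → ℝ) (w : Θ → ℝ) (q : Θ → A → ℝ) : ℝ := ∑ θ, w θ * ∑ a, q θ a * f θ a

theorem expect_const_mul (f : Θ → A → ℝ) (w : Θ → ℝ) (c : ℝ) (q : Θ → A → ℝ) :
    expect f w (fun θ a => c * q θ a) = c * expect f w q := by
  simp only [expect, mul_assoc, ← Finset.mul_sum, mul_left_comm _ c]

theorem expect_sum {ι : Type*} [Fintype ι] (f : Θ → A → ℝ) (w : Θ → ℝ) (q : ι → Θ → A → ℝ) :
    expect f w (fun θ a => ∑ i, q i θ a) = ∑ i, expect f w (q i) := by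
  simp only [expect, Finset.sum_mul]
  rw [Finset.sum_comm]
  refine Finset.sum_congr rfl fun θ _ => ?_
  rw [Finset.sum_comm, Finset.mul_sum]

/-- Signal likelihoods move freely between the unnormalized belief and the action law. -/
theorem expect_mul (f : Θ → A → ℝ) (w x : Θ → ℝ) (q : Θ → A → ℝ) :
    expect f (fun θ => w θ * x θ) q = expect f w (fun θ a => x θ * q θ a) := by
  simp only [expect, mul_assoc, ← Finset.mul_sum]

theorem value_some {M : Mechanism Θ T A} (f : Θ → A → ℝ) (s : Strategy M) (k : T) (w : Θ → ℝ) :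
    value f s (some k) w = expect f w (boundLaw s k) := by
  induction s generalizing k w with
  | leaf p => rfl
  | signal cont ih =>
    simp only [value, ih, expect_mul]
    exact (expect_sum f w _).symm
  | elicit p cont ih => exact ih k k w
  | menu p cont ih =>
    simp only [value, ih, ← expect_const_mul]
    exact (expect_sum f w _).symm

theorem value_none {M : Mechanism Θ T A} (f : Θ → A → ℝ) (s : Strategy M) (w : Θ → ℝ) :
    value f s none w = ∑ j, expect f w (jointLaw s j j) := by
  induction s generalizing w with
  | leaf p => exact Finset.sum_congr rfl fun j _ => (expect_const_mul f w _ _).symm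
  | signal cont ih =>
    simp only [value, ih, expect_mul]
    rw [Finset.sum_comm]
    exact Finset.sum_congr rfl fun j _ => (expect_sum f w _).symm
  | elicit p cont ih =>
    simp only [value, value_some]
    exact Finset.sum_congr rfl fun j _ => (expect_const_mul f w _ _).symm
  | menu p cont ih =>
    simp only [value, ih, Finset.mul_sum, ← expect_const_mul]
    rw [Finset.sum_comm]
    exact Finset.sum_congr rfl fun j _ => (expect_sum f w _).symm

/-- The right-hand side is the payoff from drawing a report from `σ j` at each recommendation `j` of
the direct mechanism, so its deviations become strategies in `M`. -/
theorem value_redirect {M : Mechanism Θ T A} (f : Θ → A → ℝ) (s : Strategy M)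
    (σ : T → stdSimplex ℝ T) (w : Θ → ℝ) :
    value f (redirect σ s) none w = ∑ j, ∑ k, σ j k * expect f w (jointLaw s j k) := by
  induction s generalizing w with
  | @leaf play p =>
    have h : ∀ j k, expect f w (jointLaw (.leaf p : Strategy (.leaf play)) j k) =
        p j * ∑ θ, w θ * ∑ a, play k a * f θ a := fun j k => expect_const_mul f w _ _
    simp only [redirect, value, mixReports_apply, h, Finset.sum_mul]
    rw [Finset.sum_comm]
    exact Finset.sum_congr rfl fun j _ => Finset.sum_congr rfl fun k _ => by ring
  | @signal G _ π next cont ih =>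
    have h : ∀ j k, expect f w (jointLaw (.signal cont : Strategy (.signal G π next)) j k) =
        ∑ g, expect f (fun θ => w θ * π θ g) (jointLaw (cont g) j k) := fun j k => by
      simp only [expect_mul]
      exact expect_sum f w _
    simp only [redirect, value, ih, h, Finset.mul_sum]
    rw [Finset.sum_comm]
    exact Finset.sum_congr rfl fun j _ => Finset.sum_comm
  | @elicit next p cont ih =>
    have h : ∀ j k, expect f w (jointLaw (.elicit p cont : Strategy (.elicit next)) j k) =
        p j * expect f w (boundLaw (cont k) k) := fun j k => expect_const_mul f w _ _
    simp only [redirect, value, value_some, mixReports_apply, h, Finset.sum_mul]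
    rw [Finset.sum_comm]
    exact Finset.sum_congr rfl fun j _ => Finset.sum_congr rfl fun k _ => by ring
  | @menu C _ _ next p cont ih =>
    have h : ∀ j k, expect f w (jointLaw (.menu p cont : Strategy (.menu C next)) j k) =
        ∑ c, p c * expect f w (jointLaw (cont c) j k) := fun j k => by
      simp only [← expect_const_mul]
      exact expect_sum f w _
    simp only [redirect, value, ih, h, Finset.mul_sum]
    rw [Finset.sum_comm]
    refine Finset.sum_congr rfl fun j _ => ?_
    rw [Finset.sum_comm]
    exact Finset.sum_congr rfl fun k _ => Finset.sum_congr rfl fun c _ => by ring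

theorem isOptimalAction_boundLaw {P : Problem Θ T A} {M : Mechanism Θ T A} (s : Strategy M)
    {k : T} {w : Θ → ℝ} (h : IsCredible P M (some k) w) (a : A) :
    IsOptimalAction P k (fun θ => w θ * boundLaw s k θ a) a := by
  induction s generalizing w with
  | @leaf play p =>
    simp only [boundLaw, mul_comm (w _)]
    exact .const_mul ((play k).2.1 a) (h a)
  | signal cont ih =>
    simp only [boundLaw, Finset.mul_sum, ← mul_assoc]
    exact isOptimalAction_sum fun g => ih g (h g)
  | elicit p cont ih => exact ih k h
  | menu p cont ih =>
    simp only [boundLaw, Finset.mul_sum, mul_left_comm (w _)]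
    exact isOptimalAction_sum fun c => .const_mul (p.2.1 c) fun _ => ih c (h c)

/-- The weight is a nonnegative combination of beliefs at leaves where an agent acting as `k` plays
`a`. Optimality is for `k`, whatever the prescription `j`. -/
theorem isOptimalAction_jointLaw {P : Problem Θ T A} {M : Mechanism Θ T A} (s : Strategy M)
    {w : Θ → ℝ} (h : IsCredible P M none w) (j k : T) (a : A) :
    IsOptimalAction P k (fun θ => w θ * jointLaw s j k θ a) a := by
  induction s generalizing w with
  | @leaf play p =>
    simp only [jointLaw, mul_left_comm (w _)]
    refine .const_mul (p.2.1 j) fun _ => ?_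
    simp only [mul_comm (w _)]
    exact .const_mul ((play k).2.1 a) (h k a)
  | signal cont ih =>
    simp only [jointLaw, Finset.mul_sum, ← mul_assoc]
    exact isOptimalAction_sum fun g => ih g (h g)
  | elicit p cont ih =>
    simp only [jointLaw, mul_left_comm (w _)]
    exact .const_mul (p.2.1 j) fun _ => isOptimalAction_boundLaw _ (h k) a
  | menu p cont ih =>
    simp only [jointLaw, Finset.mul_sum, mul_left_comm (w _)]
    exact isOptimalAction_sum fun c => .const_mul (p.2.1 c) fun _ => ih c (h c)

end Laws

/-! ### Signaling strategies of the direct mechanism. -/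

section Recommendations

variable {Θ T A : Type u} [Fintype T] [Fintype A]

/-- The distribution of the first report of a strategy, as a signaling strategy. -/
def reportSignal {M : Mechanism Θ T A} (s : Strategy M) (θ : Θ) : stdSimplex ℝ T :=
  ⟨fun j => reportLaw s j θ, fun j => reportLaw_nonneg s j θ, sum_reportLaw s θ⟩

open Classical in
/-- The distribution of the action given that the strategy prescribes `j` as first report and
that `k` is reported instead; arbitrary in the states in which `j` has probability zero. -/
def actionSignal [Nonempty A] {M : Mechanism Θ T A} (s : Strategy M) (j k : T) (θ : Θ) :
    stdSimplex ℝ A :=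
  if h : reportLaw s j θ = 0 then stdSimplex.vertex (Classical.arbitrary A)
  else ⟨fun a => jointLaw s j k θ a / reportLaw s j θ,
    fun a => div_nonneg (jointLaw_nonneg s j k θ a) (reportLaw_nonneg s j θ), by
      rw [← Finset.sum_div, sum_jointLaw, div_self h]⟩

theorem reportSignal_mul_actionSignal [Nonempty A] {M : Mechanism Θ T A} (s : Strategy M)
    (j k : T) (θ : Θ) (a : A) :
    reportSignal s θ j * actionSignal s j k θ a = jointLaw s j k θ a := by
  change reportLaw s j θ * _ = _
  by_cases h : reportLaw s j θ = 0
  · have h0 := sum_jointLaw s j k θ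
    -- Nonnegative terms with sum zero vanish, so the arbitrary default in `actionSignal` is
    -- harmless.
    rw [h, Finset.sum_eq_zero_iff_of_nonneg fun a _ => jointLaw_nonneg s j k θ a] at h0
    rw [h, h0 a (Finset.mem_univ a), zero_mul]
  · rw [actionSignal, dif_neg h]
    exact mul_div_cancel₀ _ h

theorem sum_vertex_mul {S : Type*} [Fintype S] [DecidableEq S] (x : S) (f : S → ℝ) :
    ∑ y, (stdSimplex.vertex x : stdSimplex ℝ S) y * f y = f x := by
  rw [Finset.sum_eq_single x]
  · simp
  · intro y _ hy
    simp [hy]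
  · simp

/-- The value of any strategy at a node `E_{ij}`. -/
theorem value_elicit_nodeS [Fintype Θ] (f : Θ → A → ℝ) (φ : T → Θ → stdSimplex ℝ A) (q : stdSimplex ℝ T)
    (cont : (k : T) → Strategy (nodeS (φ k))) (w : Θ → ℝ) :
    value f (.elicit q cont : Strategy (nodeE φ)) none w =
      ∑ k, q k * expect f w fun θ a => φ k θ a := by
  simp only [value, value_some]
  refine Finset.sum_congr rfl fun k _ => congrArg (q k * expect f w ·) ?_
  funext θ a
  generalize cont k = c
  cases c with
  | signal leaves =>
    classical
    have h : ∀ b, boundLaw (leaves b) k θ a = (stdSimplex.vertex b : stdSimplex ℝ A) a :=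
      fun b => by
        cases leaves b
        rfl
    simp only [boundLaw, h]
    rw [Finset.sum_eq_single a]
    · simp
    · intro b _ hb
      simp [hb.symm]
    · simp

end Recommendations

end

end CrediblePersuasion

/-! ### Credibility, payoff and incentives of the direct mechanism. -/

open CrediblePersuasion in
theorem mainTheorem1 {Θ T A : Type u} [Fintype Θ] [Fintype T] [Fintype A]
    [Nonempty T] [Nonempty A] (P : Problem Θ T A)
    (M : Mechanism Θ T A) (hM : IsCredible P M none P.μ)
    (s : T → Strategy M) (hs : ∀ t, IsBestResponse P t M (s t) none P.μ) :
    ∃ (π : T → Θ → stdSimplex ℝ T) (φ : T → T → T → Θ → stdSimplex ℝ A),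
      -- the play prescribed by the new mechanism is credible
      IsCredible P (directMechanism π φ) none P.μ ∧
      -- the principal gets at least as much
      principalPayoff P M s ≤ principalPayoff P (directMechanism π φ) (obey π φ) ∧
      -- IC at the root: type `i` selects the child `S_i`
      (∀ i, IsBestResponse P i (directMechanism π φ) (obey π φ i) none P.μ) ∧
      -- DIC at `S_i`: at `E_{ij}`, type `i` reports `j`
      (∀ i j, IsBestResponse P i (nodeE (φ i j)) (obeyE (φ i j) j) none
        (fun θ => P.μ θ * π i θ j)) ∧
      -- DIC at `S_{ijk}`: the recommended action is optimal for type `k`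
      (∀ i j k a, IsOptimalAction P k (fun θ => P.μ θ * π i θ j * φ i j k θ a) a) := by
  classical
  have opt : ∀ i j k a, IsOptimalAction P k
      (fun θ => P.μ θ * reportSignal (s i) θ j * actionSignal (s i) j k θ a) a := by
    intro i j k a
    simp only [mul_assoc, reportSignal_mul_actionSignal]
    exact isOptimalAction_jointLaw (s i) hM j k a
  have valE : ∀ f i j (q : stdSimplex ℝ T)
      (cont : (k : T) → Strategy (nodeS (actionSignal (s i) j k))),
      value f (.elicit q cont : Strategy (nodeE (actionSignal (s i) j))) none
          (fun θ => P.μ θ * reportSignal (s i) θ j) =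
        ∑ k, q k * expect f P.μ (jointLaw (s i) j k) := by
    intro f i j q cont
    rw [value_elicit_nodeS]
    simp only [expect_mul, reportSignal_mul_actionSignal]
  have valObeyE : ∀ f i j, value f (obeyE (actionSignal (s i) j) j) none
      (fun θ => P.μ θ * reportSignal (s i) θ j) = expect f P.μ (jointLaw (s i) j j) := by
    intro f i j
    exact (valE f i j _ _).trans (sum_vertex_mul j fun k => expect f P.μ (jointLaw (s i) j k))
  have valObey : ∀ f i, value f (obey (fun i => reportSignal (s i))
      (fun i => actionSignal (s i)) i) none P.μ = value f (s i) none P.μ := by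
    intro f i
    rw [value_none f (s i)]
    simp only [obey, value, valObeyE]
    exact sum_vertex_mul i fun l => ∑ j, expect f P.μ (jointLaw (s l) j j)
  refine ⟨fun i => reportSignal (s i), fun i => actionSignal (s i), ?_, ?_, ?_, ?_, opt⟩
  · intro i j k a b hb
    obtain rfl : b = a := by
      by_contra hne
      simp [hne] at hb
    exact opt i j k b
  · simp only [principalPayoff, valObey, le_refl]
  · intro i s'
    rw [valObey]
    cases s' with
    | menu p cont =>
      have bound : ∀ l, value (P.util i) (cont l) none P.μ ≤ value (P.util i) (s i) none P.μ := by
        intro l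
        generalize cont l = c
        cases c with
        | signal cont =>
          -- After selecting `S_l`, only the report distribution `q j` at each recommendation
          -- matters; together these form a redirection of `s l`.
          have hq : ∀ j, ∃ q : stdSimplex ℝ T, value (P.util i) (cont j) none
              (fun θ => P.μ θ * reportSignal (s l) θ j) =
              ∑ k, q k * expect (P.util i) P.μ (jointLaw (s l) j k) := by
            intro j
            generalize cont j = c
            cases c with
            | elicit q cont => exact ⟨q, valE _ l j q cont⟩
          choose q hq using hq
          simp only [value, hq]
          rw [← value_redirect]
          exact hs i _
      calc _ = ∑ l, p l * value (P.util i) (cont l) none P.μ := rfl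
        _ ≤ ∑ l, p l * value (P.util i) (s i) none P.μ :=
          Finset.sum_le_sum fun l _ => mul_le_mul_of_nonneg_left (bound l) (p.2.1 l)
        _ = _ := by rw [← Finset.sum_mul, stdSimplex.sum_eq_one, one_mul]
  · intro i j s'
    rw [valObeyE]
    have swap : ∀ k, expect (P.util i) P.μ (jointLaw (s i) j k) ≤
        expect (P.util i) P.μ (jointLaw (s i) j j) := by
      intro k
      -- Redirecting `j` alone leaves all other terms of the payoff equal, so global optimality of
      -- `s i` yields the inequality at the single recommendation `j`.
      have h := hs i (redirect (fun l => stdSimplex.vertex (if l = j then k else l)) (s i))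
      rw [value_redirect, value_none] at h
      simp only [sum_vertex_mul] at h
      rw [← Finset.add_sum_erase _ _ (Finset.mem_univ j),
        ← Finset.add_sum_erase _ (fun l => expect (P.util i) P.μ (jointLaw (s i) l l))
          (Finset.mem_univ j), if_pos rfl,
        Finset.sum_congr rfl fun l hl => by rw [if_neg (Finset.ne_of_mem_erase hl)]] at h
      exact le_of_add_le_add_right h
    cases s' with
    | elicit q cont =>
      refine (valE (P.util i) i j q cont).trans_le ?_
      calc _ ≤ ∑ k, q k * expect (P.util i) P.μ (jointLaw (s i) j j) :=
          Finset.sum_le_sum fun k _ => mul_le_mul_of_nonneg_left (swap k) (q.2.1 k)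
        _ = _ := by rw [← Finset.sum_mul, stdSimplex.sum_eq_one, one_mul]
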